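/- Let $n\ge 1$, $\tau\ge 0$ be integers, let $(\Omega,\mathcal F,\mathbb P)$ be a probability space with a filtration $(\mathcal F_k)_{k\ge 0}$, and for $k\ge 0$, $0\le l\le\tau$ let $A^l(k)=[a^l_{ij}(k)]$ be $\mathcal F_k$-measurable random real $n\times n$ matrices such that, almost surely, for all $i,j,l,k$: $a^l_{ij}(k)\ge 0$; $a^0_{ii}(k)>0$; $a^l_{ii}(k)=0$ for $l\ne 0$; and $\sum_{l=0}^{\tau}\sum_{j=1}^n a^l_{ij}(k)=1$. Put $B(k)=\sum_{l=0}^{\tau}A^l(k)$ and consider the system $$x_i(k+1)=\sum_{l=0}^{\tau}\sum_{j=1}^{n}a_{ij}^{l}(k)\,x_j(k-l),\qquad i=1,\dots,n,\quad k=0,1,2,\dots,$$ with initial data $x(0),x(-1),\dots,x(-\tau)\in\mathbb R^n$. For a nonnegative $n\times n$ matrix $M$ and $\delta>0$, say that $M$ has a $\delta$-spanning tree if the directed graph on $\{1,\dots,n\}$ with an edge from $j$ to $i$ exactly when $M_{ij}\ge\delta$ contains a subgraph with vertex set $\{1,\dots,n\}$ that is a directed tree: one vertex, the root, has no in-neighbour,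 every other vertex has exactly one in-neighbour, and there is a directed path from the root to every other vertex. Suppose that there exist a real number $\delta>0$ and an integer $h>0$ such that almost surely $B(k)\ge\delta I$ entrywise for all $k$, and such that for every $m\ge 0$ the (entrywise) conditional expectation $\mathbb E\{\sum_{k=m+1}^{m+h}B(k)\mid\mathcal F_m\}$ almost surely has a $\delta$-spanning tree. Then the system reaches consensus almost surely: for almost every $\omega\in\Omega$, for all initial data there is $x^*\in\mathbb R$ such that $\lim_{k\to\infty}x_i(k)=x^*$ for all $i=1,\dots,n$. -/

import Mathlib

open MeasureTheory ProbabilityTheory Filter Topology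

namespace DelayedConsensus

/-- `T` is a directed tree with root `r`: the root has no in-neighbour, every other vertex has
exactly one in-neighbour, and there is a directed path from the root to every vertex. -/
def IsDirectedTreeWithRoot {V : Type*} (T : Digraph V) (r : V) : Prop :=
  (∀ u, ¬ T.Adj u r) ∧ (∀ v, v ≠ r → ∃! u, T.Adj u v) ∧
    ∀ v, v ≠ r → Relation.TransGen T.Adj r v

/-- A directed graph has a spanning tree if some subgraph on the same vertex set is a directed
tree. -/
def HasSpanningTree {V : Type*} (G : Digraph V) : Prop :=
  ∃ T : Digraph V, T ≤ G ∧ ∃ r : V, IsDirectedTreeWithRoot T r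

/-- The graph of a nonnegative matrix `M`: there is an edge from `j` to `i` iff `M i j > 0`. -/
def matrixGraph {n : ℕ} (M : Matrix (Fin n) (Fin n) ℝ) : Digraph (Fin n) where
  Adj j i := 0 < M i j

/-- The `δ`-matrix of `M`: the entries of `M` that are smaller than `δ` are replaced by `0`. -/
noncomputable def deltaMatrix {n : ℕ} (δ : ℝ) (M : Matrix (Fin n) (Fin n) ℝ) :
    Matrix (Fin n) (Fin n) ℝ :=
  Matrix.of fun i j => if δ ≤ M i j then M i j else 0

/-- `M` has a `δ`-spanning tree: the graph of its `δ`-matrix has a spanning tree. -/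
def HasDeltaSpanningTree {n : ℕ} (δ : ℝ) (M : Matrix (Fin n) (Fin n) ℝ) : Prop :=
  HasSpanningTree (matrixGraph (deltaMatrix δ M))

/-- The standing assumptions on the weights `a l i j` (`= a_{ij}^l(k)` at one time `k`):
they are nonnegative, each agent has positive undelayed self-weight and no delayed self-weight,
and the weights that each agent uses sum to one. -/
structure IsAdmissible {n τ : ℕ} (a : Fin (τ + 1) → Matrix (Fin n) (Fin n) ℝ) : Prop where
  nonneg : ∀ l i j, 0 ≤ a l i j
  self_pos : ∀ i, 0 < a 0 i i
  no_self_delay : ∀ l, l ≠ 0 → ∀ i, a l i i = 0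
  sum_eq_one : ∀ i, ∑ l, ∑ j, a l i j = 1

/-- `x` solves `x_i(k+1) = ∑_{l ≤ τ} ∑_j a_{ij}^l(k) x_j(k-l)` for all `k ≥ 0`. The values
`x 0, x (-1), …, x (-τ)` are the arbitrary initial data; those at times `< -τ` play no role. -/
def IsTrajectory {n τ : ℕ} (a : Fin (τ + 1) → ℕ → Matrix (Fin n) (Fin n) ℝ)
    (x : ℤ → Fin n → ℝ) : Prop :=
  ∀ (k : ℕ) (i : Fin n),
    x ((k : ℤ) + 1) i = ∑ l : Fin (τ + 1), ∑ j, a l k i j * x ((k : ℤ) - ((l : ℕ) : ℤ)) j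

/-- The system reaches consensus: along every trajectory (that is, for all initial data), the
states of all the agents converge to a common real limit. -/
def ReachesConsensus {n τ : ℕ} (a : Fin (τ + 1) → ℕ → Matrix (Fin n) (Fin n) ℝ) : Prop :=
  ∀ x : ℤ → Fin n → ℝ, IsTrajectory a x →
    ∃ c : ℝ, ∀ i, Tendsto (fun k : ℕ => x (k : ℤ) i) atTop (𝓝 c)

/-- The random matrix `B(k) = ∑_{l ≤ τ} A^l(k)`. -/
def totalWeight {Ω : Type*} {n τ : ℕ}
    (A : Fin (τ + 1) → ℕ → Ω → Matrix (Fin n) (Fin n) ℝ) (k : ℕ) (ω : Ω) :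
    Matrix (Fin n) (Fin n) ℝ :=
  ∑ l, A l k ω

/-- Entrywise conditional expectation of a random matrix. -/
noncomputable def matrixCondExp {Ω : Type*} {m0 : MeasurableSpace Ω} {n : ℕ}
    (μ : Measure Ω) (m : MeasurableSpace Ω) (M : Ω → Matrix (Fin n) (Fin n) ℝ) (ω : Ω) :
    Matrix (Fin n) (Fin n) ℝ :=
  Matrix.of fun i j => (μ[fun ω' => M ω' i j | m]) ω

end DelayedConsensus

namespace DelayedConsensus

/-! Let `V(k)` be the spread (maximum minus minimum) over the window `[k, k+τ]`. Since the weights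
are nonnegative and sum to one, the distances of the states to the window maximum and minimum are
again trajectories, nonnegative from time `k` on, and `V` is nonincreasing. A positive gap cannot
vanish quickly: the undelayed self-weight keeps a fraction `δ` of it at each step, and an edge used
with weight `w` passes on a multiple of `w`.

The two gaps of an agent add up to `V(k)`, so each agent is at least `V(k)/2` away from one extreme.
This gives a set `S` of pairs (agent, side) that meets every agent. Wherever the conditional
spanning tree is rooted, the root lies in `S` on some side `σ`. Unless `S` contains that whole side,
a tree edge leaves it, and the conditional expected weight of this edge over the next block is at
least `δ`. Adding its head to `S` costs a constant factor in conditional expectation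
(`ae_mul_levelGap_le_condExp`). After `2n` blocks `S` contains a full side, so one extreme has moved
and `E V` has shrunk by a fixed factor (`integral_windowSpread_le`).

Hence `E V` decays geometrically along a subsequence. As `V` is monotone, it tends to `0` almost
surely (`ae_tendsto_windowSpread`). By linearity the finitely many unit initial data suffice, so the
exceptional null set does not depend on the initial data. -/

/-- The delayed linear recursion with time shifted by `τ`, so that the initial data are
`y 0, …, y τ`. -/
def IsShiftedTrajectory {n τ : ℕ} (a : Fin (τ + 1) → ℕ → Matrix (Fin n) (Fin n) ℝ)
    (y : ℕ → Fin n → ℝ) : Prop :=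
  ∀ (k : ℕ) (i : Fin n),
    y (k + τ + 1) i = ∑ l : Fin (τ + 1), ∑ j, a l k i j * y (k + τ - (l : ℕ)) j

/-- The weights are admissible at all times, with self-weights at least `δ`. -/
structure IsUniformlyAdmissible {n τ : ℕ} (δ : ℝ)
    (a : Fin (τ + 1) → ℕ → Matrix (Fin n) (Fin n) ℝ) : Prop where
  admissible : ∀ k, IsAdmissible fun l => a l k
  le_self : ∀ k i, δ ≤ a 0 k i i

/-! ### Pathwise estimates: persistence and propagation of gaps -/

section Deterministic

variable {n τ : ℕ} {δ : ℝ} {a : Fin (τ + 1) → ℕ → Matrix (Fin n) (Fin n) ℝ}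

theorem IsUniformlyAdmissible.nonneg (ha : IsUniformlyAdmissible δ a) (l : Fin (τ + 1)) (k : ℕ)
    (i j : Fin n) : 0 ≤ a l k i j :=
  (ha.admissible k).nonneg l i j

theorem IsUniformlyAdmissible.total_le_one (ha : IsUniformlyAdmissible δ a) (k : ℕ)
    (i j : Fin n) : ∑ l, a l k i j ≤ 1 := by
  rw [← (ha.admissible k).sum_eq_one i]
  refine Finset.sum_le_sum fun l _ => ?_
  exact Finset.single_le_sum (f := fun j => a l k i j) (fun j _ => ha.nonneg l k i j)
    (Finset.mem_univ j)

theorem IsUniformlyAdmissible.le_one [NeZero n] (ha : IsUniformlyAdmissible δ a) : δ ≤ 1 := by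
  have h1 := ha.le_self 0 0
  have h2 := ha.total_le_one 0 0 0
  have h3 := Finset.single_le_sum (f := fun l => a l 0 0 0) (fun l _ => ha.nonneg l 0 0 0)
    (Finset.mem_univ (0 : Fin (τ + 1)))
  linarith

theorem IsShiftedTrajectory.const_sub (ha : IsUniformlyAdmissible δ a) {y : ℕ → Fin n → ℝ}
    (hy : IsShiftedTrajectory a y) (c : ℝ) : IsShiftedTrajectory a fun t i => c - y t i := by
  intro k i
  simp only [hy k i, mul_sub, Finset.sum_sub_distrib, ← Finset.sum_mul]
  have := (ha.admissible k).sum_eq_one i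
  rw [this, one_mul]

theorem IsShiftedTrajectory.sub_const (ha : IsUniformlyAdmissible δ a) {y : ℕ → Fin n → ℝ}
    (hy : IsShiftedTrajectory a y) (c : ℝ) : IsShiftedTrajectory a fun t i => y t i - c := by
  intro k i
  simp only [hy k i, mul_sub, Finset.sum_sub_distrib, ← Finset.sum_mul]
  have := (ha.admissible k).sum_eq_one i
  rw [this, one_mul]

theorem IsShiftedTrajectory.nonneg (ha : IsUniformlyAdmissible δ a) {g : ℕ → Fin n → ℝ}
    (hg : IsShiftedTrajectory a g) {k : ℕ} (hw : ∀ r ≤ τ, ∀ i, 0 ≤ g (k + r) i) {t : ℕ}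
    (ht : k ≤ t) (i : Fin n) : 0 ≤ g t i := by
  induction t using Nat.strong_induction_on generalizing i with
  | _ t ih =>
    by_cases h : t ≤ k + τ
    · have := hw (t - k) (by omega) i
      rwa [Nat.add_sub_cancel' ht] at this
    · obtain ⟨q, rfl⟩ : ∃ q, t = q + τ + 1 := ⟨t - τ - 1, by omega⟩
      rw [hg q i]
      refine Finset.sum_nonneg fun l _ => Finset.sum_nonneg fun j _ =>
        mul_nonneg (ha.nonneg l q i j) (ih _ ?_ ?_ j) <;> have := l.2 <;> omega

/-- All terms of the recursion are nonnegative, and the undelayed self-term alone is at least `δ * g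
t i`. The bound `k + τ ≤ t` keeps every delayed time at or after `k`. -/
theorem IsShiftedTrajectory.mul_le_succ (ha : IsUniformlyAdmissible δ a) {g : ℕ → Fin n → ℝ}
    (hg : IsShiftedTrajectory a g) {k : ℕ} (hpos : ∀ t, k ≤ t → ∀ i, 0 ≤ g t i) {t : ℕ}
    (ht : k + τ ≤ t) (i : Fin n) : δ * g t i ≤ g (t + 1) i := by
  obtain ⟨q, rfl⟩ : ∃ q, t = q + τ := ⟨t - τ, by omega⟩
  have hnn : ∀ l : Fin (τ + 1), ∀ j, 0 ≤ a l q i j * g (q + τ - (l : ℕ)) j := fun l j =>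
    mul_nonneg (ha.nonneg l q i j) (hpos _ (by have := l.2; omega) j)
  rw [hg q i]
  calc δ * g (q + τ) i ≤ a 0 q i i * g (q + τ - ((0 : Fin (τ + 1)) : ℕ)) i := by
        simpa using mul_le_mul_of_nonneg_right (ha.le_self q i) (hpos (q + τ) (by omega) i)
    _ ≤ ∑ j, a 0 q i j * g (q + τ - ((0 : Fin (τ + 1)) : ℕ)) j :=
        Finset.single_le_sum (f := fun j => a 0 q i j * g (q + τ - ((0 : Fin (τ + 1)) : ℕ)) j)
          (fun j _ => hnn 0 j) (Finset.mem_univ i)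
    _ ≤ _ := Finset.single_le_sum
          (f := fun l : Fin (τ + 1) => ∑ j, a l q i j * g (q + τ - (l : ℕ)) j)
          (fun l _ => Finset.sum_nonneg fun j _ => hnn l j) (Finset.mem_univ 0)

theorem IsShiftedTrajectory.pow_mul_le (hδ : 0 ≤ δ) (ha : IsUniformlyAdmissible δ a)
    {g : ℕ → Fin n → ℝ} (hg : IsShiftedTrajectory a g) {k : ℕ}
    (hpos : ∀ t, k ≤ t → ∀ i, 0 ≤ g t i) {t : ℕ} (ht : k + τ ≤ t) (r : ℕ) (i : Fin n) :
    δ ^ r * g t i ≤ g (t + r) i := by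
  induction r with
  | zero => simp
  | succ r ih =>
    calc δ ^ (r + 1) * g t i = δ * (δ ^ r * g t i) := by ring
      _ ≤ δ * g (t + r) i := mul_le_mul_of_nonneg_left ih hδ
      _ ≤ g (t + r + 1) i := hg.mul_le_succ ha hpos (by omega) i

/-- An edge of positive weight during the block `[t+1, t+h]` propagates a gap. -/
theorem IsShiftedTrajectory.weight_mul_le [NeZero n] (hδ : 0 ≤ δ) (ha : IsUniformlyAdmissible δ a)
    {g : ℕ → Fin n → ℝ} (hg : IsShiftedTrajectory a g) {k : ℕ}
    (hpos : ∀ t, k ≤ t → ∀ i, 0 ≤ g t i) {t : ℕ} (ht : k + τ ≤ t) {q h : ℕ}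
    (hq : q ∈ Finset.Icc (t + 1) (t + h)) (i j : Fin n) :
    δ ^ (2 * (τ + h + 1)) * ((∑ l, a l q i j) * g t j) ≤ g (t + (τ + h + 1)) i := by
  have hδ1 : δ ≤ 1 := ha.le_one
  rw [Finset.mem_Icc] at hq
  have hgj := hpos t (by omega) j
  have hterm : ∀ l : Fin (τ + 1), ∀ j, 0 ≤ a l q i j * g (q + τ - (l : ℕ)) j := fun l j =>
    mul_nonneg (ha.nonneg l q i j) (hpos _ (by have := l.2; omega) j)
  have h1 : δ ^ (τ + h + 1) * ((∑ l, a l q i j) * g t j) ≤ g (q + τ + 1) i := by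
    rw [hg q i, Finset.sum_mul, Finset.mul_sum]
    refine Finset.sum_le_sum fun l _ => ?_
    have hl := l.2
    refine le_trans ?_ (Finset.single_le_sum
      (f := fun j => a l q i j * g (q + τ - (l : ℕ)) j) (fun j _ => hterm l j)
      (Finset.mem_univ j))
    have h2 := hg.pow_mul_le hδ ha hpos ht (q + τ - (l : ℕ) - t) j
    rw [Nat.add_sub_cancel' (by omega)] at h2
    have h3 : δ ^ (τ + h + 1) ≤ δ ^ (q + τ - (l : ℕ) - t) :=
      pow_le_pow_of_le_one hδ hδ1 (by omega)
    have h4 := (mul_le_mul_of_nonneg_right h3 hgj).trans h2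
    calc δ ^ (τ + h + 1) * (a l q i j * g t j) = a l q i j * (δ ^ (τ + h + 1) * g t j) := by ring
      _ ≤ _ := mul_le_mul_of_nonneg_left h4 (ha.nonneg l q i j)
  have h5 := hg.pow_mul_le hδ ha hpos (t := q + τ + 1) (by omega) (t + (τ + h + 1) - (q + τ + 1)) i
  rw [Nat.add_sub_cancel' (by omega)] at h5
  have h6 : δ ^ (τ + h + 1) ≤ δ ^ (t + (τ + h + 1) - (q + τ + 1)) :=
    pow_le_pow_of_le_one hδ hδ1 (by omega)
  calc δ ^ (2 * (τ + h + 1)) * ((∑ l, a l q i j) * g t j)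
      = δ ^ (τ + h + 1) * (δ ^ (τ + h + 1) * ((∑ l, a l q i j) * g t j)) := by ring
    _ ≤ δ ^ (τ + h + 1) * g (q + τ + 1) i := mul_le_mul_of_nonneg_left h1 (by positivity)
    _ ≤ _ := (mul_le_mul_of_nonneg_right h6 (hpos _ (by omega) i)).trans h5

/-- The total weight of the edge from `j` to `i` during the block `[t+1, t+h]`. -/
noncomputable def blockWeight (a : Fin (τ + 1) → ℕ → Matrix (Fin n) (Fin n) ℝ) (t h : ℕ)
    (i j : Fin n) : ℝ :=
  ∑ q ∈ Finset.Icc (t + 1) (t + h), ∑ l, a l q i j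

/-- The contraction constant of one block. -/
noncomputable def blockConst (δ : ℝ) (τ h : ℕ) : ℝ := δ ^ (2 * (τ + h + 1)) / h

theorem blockConst_pos (hδ : 0 < δ) {h : ℕ} (hh : 0 < h) : 0 < blockConst δ τ h := by
  unfold blockConst
  positivity

theorem blockWeight_nonneg (ha : IsUniformlyAdmissible δ a) (t h : ℕ) (i j : Fin n) :
    0 ≤ blockWeight a t h i j :=
  Finset.sum_nonneg fun q _ => Finset.sum_nonneg fun l _ => ha.nonneg l q i j

theorem blockWeight_le (ha : IsUniformlyAdmissible δ a) (t h : ℕ) (i j : Fin n) :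
    blockWeight a t h i j ≤ h := by
  calc blockWeight a t h i j ≤ ∑ _q ∈ Finset.Icc (t + 1) (t + h), (1 : ℝ) :=
        Finset.sum_le_sum fun q _ => ha.total_le_one q i j
    _ = h := by simp

theorem blockConst_mul_blockWeight_le (hδ : 0 ≤ δ) (ha : IsUniformlyAdmissible δ a) (t : ℕ)
    {h : ℕ} (hh : 0 < h) (i j : Fin n) :
    blockConst δ τ h * blockWeight a t h i j ≤ δ ^ (2 * (τ + h + 1)) := by
  have hh' : (0 : ℝ) < h := by exact_mod_cast hh
  rw [blockConst, div_mul_eq_mul_div, div_le_iff₀ hh']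
  exact mul_le_mul_of_nonneg_left (blockWeight_le ha t h i j) (by positivity)

/-- Averaging the one-edge bound over the `h` times of the block makes it linear in the total
weight, so that it can be conditioned on the past. -/
theorem IsShiftedTrajectory.blockConst_mul_le_gap [NeZero n] (hδ : 0 ≤ δ)
    (ha : IsUniformlyAdmissible δ a) {g : ℕ → Fin n → ℝ} (hg : IsShiftedTrajectory a g) {k : ℕ}
    (hpos : ∀ t, k ≤ t → ∀ i, 0 ≤ g t i) {t : ℕ} (ht : k + τ ≤ t) {h : ℕ} (hh : 0 < h)
    (i j : Fin n) :
    blockConst δ τ h * blockWeight a t h i j * g t j ≤ g (t + (τ + h + 1)) i := by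
  have hh' : (0 : ℝ) < h := by exact_mod_cast hh
  have key : ∑ q ∈ Finset.Icc (t + 1) (t + h),
      δ ^ (2 * (τ + h + 1)) * ((∑ l, a l q i j) * g t j) ≤
      ∑ _q ∈ Finset.Icc (t + 1) (t + h), g (t + (τ + h + 1)) i :=
    Finset.sum_le_sum fun q hq => hg.weight_mul_le hδ ha hpos ht hq i j
  rw [← Finset.mul_sum, ← Finset.sum_mul] at key
  simp only [Finset.sum_const, Nat.card_Icc, nsmul_eq_mul] at key
  have hc : t + h + 1 - (t + 1) = h := by omega
  rw [hc] at key
  rw [blockConst, div_mul_eq_mul_div, div_mul_eq_mul_div, div_le_iff₀ hh', blockWeight]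
  linarith

/-! ### Window extremes and two-sided gaps -/

/-- The largest state in the window `[k, k+τ]`. -/
noncomputable def windowMax [NeZero n] (τ : ℕ) (y : ℕ → Fin n → ℝ) (k : ℕ) : ℝ :=
  (Finset.univ : Finset (Fin (τ + 1) × Fin n)).sup' Finset.univ_nonempty
    fun p => y (k + p.1) p.2

/-- The smallest state in the window `[k, k+τ]`. -/
noncomputable def windowMin [NeZero n] (τ : ℕ) (y : ℕ → Fin n → ℝ) (k : ℕ) : ℝ :=
  (Finset.univ : Finset (Fin (τ + 1) × Fin n)).inf' Finset.univ_nonempty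
    fun p => y (k + p.1) p.2

/-- The spread of the states in the window `[k, k+τ]`. -/
noncomputable def windowSpread [NeZero n] (τ : ℕ) (y : ℕ → Fin n → ℝ) (k : ℕ) : ℝ :=
  windowMax τ y k - windowMin τ y k

/-- The distance of the state of agent `p.1` to the window maximum (`p.2 = true`) or to the
window minimum (`p.2 = false`). -/
noncomputable def gap [NeZero n] (τ : ℕ) (y : ℕ → Fin n → ℝ) (k t : ℕ) (p : Fin n × Bool) : ℝ :=
  if p.2 then windowMax τ y k - y t p.1 else y t p.1 - windowMin τ y k

variable [NeZero n] {y : ℕ → Fin n → ℝ}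

theorem le_windowMax (y : ℕ → Fin n → ℝ) (k : ℕ) {r : ℕ} (hr : r ≤ τ) (i : Fin n) :
    y (k + r) i ≤ windowMax τ y k :=
  Finset.le_sup' (fun p : Fin (τ + 1) × Fin n => y (k + p.1) p.2)
    (Finset.mem_univ ((⟨r, by omega⟩ : Fin (τ + 1)), i))

theorem windowMin_le (y : ℕ → Fin n → ℝ) (k : ℕ) {r : ℕ} (hr : r ≤ τ) (i : Fin n) :
    windowMin τ y k ≤ y (k + r) i :=
  Finset.inf'_le (fun p : Fin (τ + 1) × Fin n => y (k + p.1) p.2)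
    (Finset.mem_univ ((⟨r, by omega⟩ : Fin (τ + 1)), i))

theorem windowMax_le {k : ℕ} {c : ℝ} (h : ∀ r ≤ τ, ∀ i, y (k + r) i ≤ c) :
    windowMax τ y k ≤ c :=
  Finset.sup'_le _ _ fun p _ => h p.1 (by have := p.1.2; omega) p.2

theorem le_windowMin {k : ℕ} {c : ℝ} (h : ∀ r ≤ τ, ∀ i, c ≤ y (k + r) i) :
    c ≤ windowMin τ y k :=
  Finset.le_inf' _ _ fun p _ => h p.1 (by have := p.1.2; omega) p.2

theorem windowSpread_nonneg (y : ℕ → Fin n → ℝ) (k : ℕ) : 0 ≤ windowSpread τ y k :=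
  sub_nonneg.2 ((windowMin_le y k (Nat.zero_le τ) 0).trans (le_windowMax y k (Nat.zero_le τ) 0))

theorem isShiftedTrajectory_gap (ha : IsUniformlyAdmissible δ a) (hy : IsShiftedTrajectory a y)
    (k : ℕ) (σ : Bool) : IsShiftedTrajectory a fun t i => gap τ y k t (i, σ) := by
  cases σ
  · simpa [gap] using hy.sub_const ha _
  · simpa [gap] using hy.const_sub ha _

theorem gap_nonneg (ha : IsUniformlyAdmissible δ a) (hy : IsShiftedTrajectory a y) {k t : ℕ}
    (ht : k ≤ t) (p : Fin n × Bool) : 0 ≤ gap τ y k t p := by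
  obtain ⟨i, σ⟩ := p
  refine (isShiftedTrajectory_gap ha hy k σ).nonneg ha (fun r hr i => ?_) ht i
  cases σ
  · simpa [gap] using windowMin_le y k hr i
  · simpa [gap] using le_windowMax y k hr i

theorem gap_true_add_gap_false (y : ℕ → Fin n → ℝ) (k t : ℕ) (i : Fin n) :
    gap τ y k t (i, true) + gap τ y k t (i, false) = windowSpread τ y k := by
  simp [gap, windowSpread]

theorem antitone_windowMax (ha : IsUniformlyAdmissible δ a) (hy : IsShiftedTrajectory a y) :
    Antitone (windowMax τ y) := fun k k' hk => windowMax_le fun r _ i => by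
  have := gap_nonneg ha hy (k := k) (t := k' + r) (by omega) (i, true)
  simpa [gap] using this

theorem monotone_windowMin (ha : IsUniformlyAdmissible δ a) (hy : IsShiftedTrajectory a y) :
    Monotone (windowMin τ y) := fun k k' hk => le_windowMin fun r _ i => by
  have := gap_nonneg ha hy (k := k) (t := k' + r) (by omega) (i, false)
  simpa [gap] using this

theorem antitone_windowSpread (ha : IsUniformlyAdmissible δ a) (hy : IsShiftedTrajectory a y) :
    Antitone (windowSpread τ y) := fun _ _ hk =>
  sub_le_sub (antitone_windowMax ha hy hk) (monotone_windowMin ha hy hk)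

/-- If all the agents have gap at least `r` on one side at time `t`, then the spread decreases. -/
theorem windowSpread_le_of_le_gap (hδ : 0 ≤ δ) (ha : IsUniformlyAdmissible δ a)
    (hy : IsShiftedTrajectory a y) {k t : ℕ} (ht : k + τ ≤ t) {σ : Bool} {c : ℝ} (hc : 0 ≤ c)
    (hgap : ∀ i, c ≤ gap τ y k t (i, σ)) :
    windowSpread τ y t ≤ windowSpread τ y k - δ ^ τ * c := by
  have hδ1 : δ ≤ 1 := ha.le_one
  have hmax := antitone_windowMax ha hy (show k ≤ t by omega)
  have hmin := monotone_windowMin ha hy (show k ≤ t by omega)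
  -- The extreme of the new window involves all of `[t, t+τ]`, so the gap must survive up to `τ`
  -- further steps.
  have key : ∀ r ≤ τ, ∀ i, δ ^ τ * c ≤ gap τ y k (t + r) (i, σ) := fun r hr i =>
    calc δ ^ τ * c ≤ δ ^ r * c :=
          mul_le_mul_of_nonneg_right (pow_le_pow_of_le_one hδ hδ1 hr) hc
      _ ≤ δ ^ r * gap τ y k t (i, σ) := mul_le_mul_of_nonneg_left (hgap i) (by positivity)
      _ ≤ _ := (isShiftedTrajectory_gap ha hy k σ).pow_mul_le hδ ha
          (fun t ht i => gap_nonneg ha hy ht (i, σ)) ht r i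
  unfold windowSpread
  cases σ
  · have : windowMin τ y k + δ ^ τ * c ≤ windowMin τ y t := le_windowMin fun r hr i => by
      have := key r hr i
      simp only [gap, Bool.false_eq_true, if_false] at this
      linarith
    linarith
  · have : windowMax τ y t ≤ windowMax τ y k - δ ^ τ * c := windowMax_le fun r hr i => by
      have := key r hr i
      simp only [gap, if_true] at this
      linarith
    linarith

theorem exists_tendsto_of_windowSpread (ha : IsUniformlyAdmissible δ a)
    (hy : IsShiftedTrajectory a y) (h : Tendsto (windowSpread τ y) atTop (𝓝 0)) :
    ∃ c : ℝ, ∀ i, Tendsto (fun t => y t i) atTop (𝓝 c) := by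
  have hbdd : BddBelow (Set.range (windowMax τ y)) := by
    refine ⟨windowMin τ y 0, ?_⟩
    rintro _ ⟨k, rfl⟩
    have h1 := monotone_windowMin ha hy (Nat.zero_le k)
    have h2 := windowSpread_nonneg (τ := τ) y k
    unfold windowSpread at h2
    linarith
  have hmax := tendsto_atTop_ciInf (antitone_windowMax ha hy) hbdd
  refine ⟨⨅ k, windowMax τ y k, fun i => ?_⟩
  have hmin : Tendsto (windowMin τ y) atTop (𝓝 (⨅ k, windowMax τ y k)) := by
    have := hmax.sub h
    simpa [windowSpread] using this
  exact tendsto_of_tendsto_of_tendsto_of_le_of_le hmin hmax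
    (fun t => windowMin_le y t (Nat.zero_le τ) i) (fun t => le_windowMax y t (Nat.zero_le τ) i)

end Deterministic

/-! ### Max-min gaps over sets of sided agents -/

section LevelSets

/-- The set `S` contains all the agents, on one side. -/
def IsFullSide {n : ℕ} (S : Finset (Fin n × Bool)) : Prop := ∃ σ, ∀ i, (i, σ) ∈ S

/-- The sets of sided agents that meet every agent, and that have at least `s` elements or
contain one full side. -/
def levelSets (n s : ℕ) : Set (Finset (Fin n × Bool)) :=
  {S | (∀ i, ∃ σ, (i, σ) ∈ S) ∧ (s ≤ S.card ∨ IsFullSide S)}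

open Classical in
/-- `levelSets` as a `Finset`. -/
noncomputable def levelFinset (n s : ℕ) : Finset (Finset (Fin n × Bool)) :=
  Finset.univ.filter fun S => S ∈ levelSets n s

theorem mem_levelFinset {n s : ℕ} {S : Finset (Fin n × Bool)} :
    S ∈ levelFinset n s ↔ S ∈ levelSets n s := by
  simp [levelFinset]

theorem levelFinset_nonempty (n s : ℕ) : (levelFinset n s).Nonempty :=
  ⟨Finset.univ, mem_levelFinset.2 ⟨fun _ => ⟨true, Finset.mem_univ _⟩,
    Or.inr ⟨true, fun _ => Finset.mem_univ _⟩⟩⟩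

/-- A set with a full side need not grow any more; the second alternative in `levelSets` carries it
through the remaining levels. -/
theorem mem_levelSets_succ_of_isFullSide {n s : ℕ} {S : Finset (Fin n × Bool)}
    (hS : S ∈ levelSets n s) (hfull : IsFullSide S) : S ∈ levelSets n (s + 1) :=
  ⟨hS.1, Or.inr hfull⟩

theorem insert_mem_levelSets {n s : ℕ} {S : Finset (Fin n × Bool)} (hS : S ∈ levelSets n s)
    (hfull : ¬ IsFullSide S) {p : Fin n × Bool} (hp : p ∉ S) :
    insert p S ∈ levelSets n (s + 1) := by
  refine ⟨fun i => (hS.1 i).imp fun σ h => Finset.mem_insert_of_mem h, Or.inl ?_⟩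
  rw [Finset.card_insert_of_notMem hp]
  exact Nat.succ_le_succ (hS.2.resolve_right hfull)

theorem isFullSide_of_mem_levelSets {n : ℕ} {S : Finset (Fin n × Bool)}
    (hS : S ∈ levelSets n (2 * n)) : IsFullSide S := by
  refine hS.2.elim (fun h => ⟨true, fun i => ?_⟩) id
  have : S = Finset.univ := by
    refine Finset.eq_univ_of_card S (le_antisymm (Finset.card_le_univ S) ?_)
    simpa [mul_comm] using h
  exact this ▸ Finset.mem_univ _

/-- A spanning tree has an edge that leaves any proper vertex set containing the root: if `S`
meets every agent and has no full side, then some edge of weight at least `δ` leaves one of its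
sides. -/
theorem HasDeltaSpanningTree.exists_edge {n : ℕ} {δ : ℝ}
    {M : Matrix (Fin n) (Fin n) ℝ} (hM : HasDeltaSpanningTree δ M) {S : Finset (Fin n × Bool)}
    (hcover : ∀ i, ∃ σ, (i, σ) ∈ S) (hfull : ¬ IsFullSide S) :
    ∃ i j σ, (j, σ) ∈ S ∧ (i, σ) ∉ S ∧ δ ≤ M i j := by
  obtain ⟨T, hT, r, -, -, hpath⟩ := hM
  -- The root depends on the matrix, but `S` meets every agent, so the root occurs on some side `σ`.
  -- If no heavy edge left that side, every vertex reachable from the root would lie in it.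
  obtain ⟨σ, hr⟩ := hcover r
  by_contra! hno
  refine hfull ⟨σ, fun v => ?_⟩
  by_cases hv : v = r
  · rwa [hv]
  have step : ∀ u w, T.Adj u w → (u, σ) ∈ S → (w, σ) ∈ S := fun u w huw hu => by
    by_contra hw
    have h1 : 0 < deltaMatrix δ M w u := hT huw
    have h2 := hno w u σ hu hw
    rw [deltaMatrix, Matrix.of_apply, if_neg (not_le.2 h2)] at h1
    exact lt_irrefl _ h1
  have := hpath v hv
  induction this with
  | single h => exact step _ _ h hr
  | @tail b c hb hbc ih =>
    by_cases hbr : b = r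
    · exact step _ _ hbc (hbr ▸ hr)
    · exact step _ _ hbc (ih hbr)

variable {n : ℕ} [NeZero n]

open Classical in
/-- The smallest value of `G` on `S`, cut off at `K`. -/
noncomputable def setGap (K : ℝ) (G : Fin n × Bool → ℝ) (S : Finset (Fin n × Bool)) : ℝ :=
  (Finset.univ : Finset (Fin n × Bool)).inf' Finset.univ_nonempty fun p => if p ∈ S then G p else K

/-- The largest `setGap` among the sets of level `s`. -/
noncomputable def levelGap (s : ℕ) (K : ℝ) (G : Fin n × Bool → ℝ) : ℝ :=
  (levelFinset n s).sup' (levelFinset_nonempty n s) (setGap K G)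

theorem le_setGap {K : ℝ} {G : Fin n × Bool → ℝ} {S : Finset (Fin n × Bool)} {c : ℝ}
    (hG : ∀ p ∈ S, c ≤ G p) (hK : c ≤ K) : c ≤ setGap K G S :=
  Finset.le_inf' _ _ fun p _ => by
    split_ifs with h
    exacts [hG p h, hK]

theorem setGap_le_of_mem {K : ℝ} {G : Fin n × Bool → ℝ} {S : Finset (Fin n × Bool)}
    {p : Fin n × Bool} (hp : p ∈ S) : setGap K G S ≤ G p := by
  classical
  refine (Finset.inf'_le _ (Finset.mem_univ p)).trans ?_
  rw [if_pos hp]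

theorem setGap_le {K : ℝ} {G : Fin n × Bool → ℝ} (hG : ∀ p, G p ≤ K)
    (S : Finset (Fin n × Bool)) : setGap K G S ≤ K := by
  classical
  refine (Finset.inf'_le _ (Finset.mem_univ ((0 : Fin n), true))).trans ?_
  split_ifs
  exacts [hG _, le_rfl]

theorem setGap_le_levelGap {s : ℕ} {K : ℝ} {G : Fin n × Bool → ℝ} {S : Finset (Fin n × Bool)}
    (hS : S ∈ levelSets n s) : setGap K G S ≤ levelGap s K G :=
  Finset.le_sup' (setGap K G) (mem_levelFinset.2 hS)

theorem exists_levelGap_eq (s : ℕ) (K : ℝ) (G : Fin n × Bool → ℝ) :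
    ∃ S ∈ levelSets n s, levelGap s K G = setGap K G S := by
  obtain ⟨S, hS, h⟩ := Finset.exists_mem_eq_sup' (levelFinset_nonempty n s) (setGap K G)
  exact ⟨S, mem_levelFinset.1 hS, h⟩

/-- The witness consists of the sided agents with gap at least `K / 2`; two gaps below `K / 2`
cannot add up to `K`. -/
theorem half_le_levelGap_zero {K : ℝ} (hK : 0 ≤ K) {G : Fin n × Bool → ℝ}
    (hG : ∀ i, G (i, true) + G (i, false) = K) : K / 2 ≤ levelGap 0 K G := by
  classical
  let S : Finset (Fin n × Bool) := Finset.univ.filter fun p => K / 2 ≤ G p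
  have hS : S ∈ levelSets n 0 := by
    refine ⟨fun i => ?_, Or.inl (Nat.zero_le _)⟩
    by_contra! h
    have h1 := h true
    have h2 := h false
    simp only [S, Finset.mem_filter, Finset.mem_univ, true_and, not_le] at h1 h2
    linarith [hG i]
  refine (le_setGap (fun p hp => ?_) (by linarith)).trans (setGap_le_levelGap hS)
  simpa [S] using hp

variable {Ω : Type*} {m : MeasurableSpace Ω}

theorem measurable_setGap {K : Ω → ℝ} {G : Ω → Fin n × Bool → ℝ} (hK : Measurable K)
    (hG : ∀ p, Measurable fun ω => G ω p) (S : Finset (Fin n × Bool)) :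
    Measurable fun ω => setGap (K ω) (G ω) S := by
  classical
  have : (fun ω => setGap (K ω) (G ω) S) = (Finset.univ : Finset (Fin n × Bool)).inf'
      Finset.univ_nonempty fun p ω => if p ∈ S then G ω p else K ω := by
    ext ω
    simp [setGap, Finset.inf'_apply]
  rw [this]
  refine Finset.inf'_induction _ _ (fun _ hf _ hg => hf.inf hg) fun p _ => ?_
  split_ifs
  exacts [hG p, hK]

theorem measurable_levelGap {K : Ω → ℝ} {G : Ω → Fin n × Bool → ℝ} (hK : Measurable K)
    (hG : ∀ p, Measurable fun ω => G ω p) (s : ℕ) :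
    Measurable fun ω => levelGap s (K ω) (G ω) := by
  have : (fun ω => levelGap s (K ω) (G ω)) = (levelFinset n s).sup'
      (levelFinset_nonempty n s) fun S ω => setGap (K ω) (G ω) S := by
    ext ω
    simp [levelGap, Finset.sup'_apply]
  rw [this]
  exact Finset.measurable_sup' _ fun S _ => measurable_setGap hK hG S

theorem measurable_windowMax {τ : ℕ} {y : ℕ → Ω → Fin n → ℝ} {k : ℕ}
    (hy : ∀ t ≤ k + τ, ∀ i, Measurable fun ω => y t ω i) :
    Measurable fun ω => windowMax τ (fun t => y t ω) k := by
  have : (fun ω => windowMax τ (fun t => y t ω) k) =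
      (Finset.univ : Finset (Fin (τ + 1) × Fin n)).sup' Finset.univ_nonempty
        fun p ω => y (k + p.1) ω p.2 := by
    ext ω
    simp [windowMax, Finset.sup'_apply]
  rw [this]
  exact Finset.measurable_sup' _ fun p _ => hy _ (by have := p.1.2; omega) _

theorem measurable_windowMin {τ : ℕ} {y : ℕ → Ω → Fin n → ℝ} {k : ℕ}
    (hy : ∀ t ≤ k + τ, ∀ i, Measurable fun ω => y t ω i) :
    Measurable fun ω => windowMin τ (fun t => y t ω) k := by
  have : (fun ω => windowMin τ (fun t => y t ω) k) =
      (Finset.univ : Finset (Fin (τ + 1) × Fin n)).inf' Finset.univ_nonempty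
        fun p ω => y (k + p.1) ω p.2 := by
    ext ω
    simp [windowMin, Finset.inf'_apply]
  rw [this]
  exact Finset.inf'_induction _ _ (fun _ hf _ hg => hf.inf hg)
    fun p _ => hy _ (by have := p.1.2; omega) _

theorem measurable_windowSpread {τ : ℕ} {y : ℕ → Ω → Fin n → ℝ} {k : ℕ}
    (hy : ∀ t ≤ k + τ, ∀ i, Measurable fun ω => y t ω i) :
    Measurable fun ω => windowSpread τ (fun t => y t ω) k :=
  (measurable_windowMax hy).sub (measurable_windowMin hy)

theorem measurable_gap {τ : ℕ} {y : ℕ → Ω → Fin n → ℝ} {k t : ℕ} (ht : k + τ ≤ t)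
    (hy : ∀ r ≤ t, ∀ i, Measurable fun ω => y r ω i) (p : Fin n × Bool) :
    Measurable fun ω => gap τ (fun t => y t ω) k t p := by
  unfold gap
  split_ifs
  · exact (measurable_windowMax fun r hr i => hy r (hr.trans ht) i).sub (hy t le_rfl _)
  · exact (hy t le_rfl _).sub (measurable_windowMin fun r hr i => hy r (hr.trans ht) i)

end LevelSets

/-! ### One block, for a fixed set of sided agents -/

section Stage

variable {n τ : ℕ} [NeZero n] {δ : ℝ} {a : Fin (τ + 1) → ℕ → Matrix (Fin n) (Fin n) ℝ}
  {y : ℕ → Fin n → ℝ}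

theorem gap_le_windowSpread (ha : IsUniformlyAdmissible δ a) (hy : IsShiftedTrajectory a y)
    {k t : ℕ} (ht : k ≤ t) (p : Fin n × Bool) : gap τ y k t p ≤ windowSpread τ y k := by
  obtain ⟨i, σ⟩ := p
  have h := gap_true_add_gap_false (τ := τ) y k t i
  have h1 := gap_nonneg ha hy ht (i, true)
  have h2 := gap_nonneg ha hy ht (i, false)
  cases σ <;> linarith

theorem setGap_gap_nonneg (ha : IsUniformlyAdmissible δ a) (hy : IsShiftedTrajectory a y)
    {k t : ℕ} (ht : k ≤ t) (S : Finset (Fin n × Bool)) :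
    0 ≤ setGap (windowSpread τ y k) (gap τ y k t) S :=
  le_setGap (fun p _ => gap_nonneg ha hy ht p) (windowSpread_nonneg y k)

/-- The constant `c` is left free so that it can be a multiple of the block weight of an edge, and
not just a power of `δ`. -/
theorem mul_setGap_le_setGap (hδ : 0 ≤ δ) (ha : IsUniformlyAdmissible δ a)
    (hy : IsShiftedTrajectory a y) {k t : ℕ} (ht : k + τ ≤ t) {r : ℕ} {c : ℝ}
    (hc : c ≤ δ ^ r) (S : Finset (Fin n × Bool)) :
    c * setGap (windowSpread τ y k) (gap τ y k t) S ≤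
      setGap (windowSpread τ y k) (gap τ y k (t + r)) S := by
  have h0 := setGap_gap_nonneg ha hy (show k ≤ t by omega) S
  refine le_setGap (fun p hp => ?_) ?_
  · calc c * setGap (windowSpread τ y k) (gap τ y k t) S
        ≤ δ ^ r * gap τ y k t p :=
          mul_le_mul hc (setGap_le_of_mem hp) h0 (by positivity)
      _ ≤ _ := (isShiftedTrajectory_gap ha hy k p.2).pow_mul_le hδ ha
          (fun t ht i => gap_nonneg ha hy ht (i, p.2)) ht r p.1
  · have h1 : c ≤ 1 := hc.trans (pow_le_one₀ hδ ha.le_one)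
    calc c * setGap (windowSpread τ y k) (gap τ y k t) S
        ≤ 1 * setGap (windowSpread τ y k) (gap τ y k t) S := mul_le_mul_of_nonneg_right h1 h0
      _ ≤ _ := by
        rw [one_mul]
        exact setGap_le (gap_le_windowSpread ha hy (show k ≤ t by omega)) S

open Classical in
-- The new element is fed by the edge from `j`, and the old ones persist by their self-weights.
-- `blockConst` is small enough for the same random factor to bound both.
theorem mul_setGap_le_setGap_insert (hδ : 0 ≤ δ) (ha : IsUniformlyAdmissible δ a)
    (hy : IsShiftedTrajectory a y) {k t : ℕ} (ht : k + τ ≤ t) {h : ℕ} (hh : 0 < h)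
    {S : Finset (Fin n × Bool)} {i j : Fin n} {σ : Bool} (hj : (j, σ) ∈ S) :
    blockConst δ τ h * blockWeight a t h i j * setGap (windowSpread τ y k) (gap τ y k t) S ≤
      setGap (windowSpread τ y k) (gap τ y k (t + (τ + h + 1))) (insert (i, σ) S) := by
  have hc : blockConst δ τ h * blockWeight a t h i j ≤ δ ^ (τ + h + 1) :=
    (blockConst_mul_blockWeight_le hδ ha t hh i j).trans
      (pow_le_pow_of_le_one hδ ha.le_one (by omega))
  have hc0 : 0 ≤ blockConst δ τ h * blockWeight a t h i j :=
    mul_nonneg (by unfold blockConst; positivity) (blockWeight_nonneg ha t h i j)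
  have hstay := mul_setGap_le_setGap hδ ha hy ht hc S
  refine le_setGap (fun p hp => ?_)
    (hstay.trans (setGap_le (gap_le_windowSpread ha hy (by omega)) S))
  rcases Finset.mem_insert.1 hp with rfl | hp
  · exact (mul_le_mul_of_nonneg_left (setGap_le_of_mem hj) hc0).trans
      ((isShiftedTrajectory_gap ha hy k σ).blockConst_mul_le_gap hδ ha
        (fun t ht i => gap_nonneg ha hy ht (i, σ)) ht hh i j)
  · exact hstay.trans (setGap_le_of_mem hp)

theorem blockConst_mul_le (hδ : 0 ≤ δ) (hδ1 : δ ≤ 1) {h : ℕ} (hh : 0 < h) :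
    blockConst δ τ h * δ ≤ δ ^ (τ + h + 1) := by
  have hh' : (1 : ℝ) ≤ h := by exact_mod_cast hh
  calc blockConst δ τ h * δ ≤ blockConst δ τ h * 1 :=
        mul_le_mul_of_nonneg_left hδ1 (by unfold blockConst; positivity)
    _ ≤ δ ^ (2 * (τ + h + 1)) := by
        rw [mul_one, blockConst]
        exact div_le_self (by positivity) hh'
    _ ≤ _ := pow_le_pow_of_le_one hδ hδ1 (by omega)

theorem levelGap_le_windowSpread (ha : IsUniformlyAdmissible δ a) (hy : IsShiftedTrajectory a y)
    {k t : ℕ} (ht : k ≤ t) (s : ℕ) :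
    levelGap s (windowSpread τ y k) (gap τ y k t) ≤ windowSpread τ y k :=
  Finset.sup'_le _ _ fun S _ => setGap_le (gap_le_windowSpread ha hy ht) S

theorem levelGap_nonneg (ha : IsUniformlyAdmissible δ a) (hy : IsShiftedTrajectory a y)
    {k t : ℕ} (ht : k ≤ t) (s : ℕ) :
    0 ≤ levelGap s (windowSpread τ y k) (gap τ y k t) := by
  obtain ⟨S, -, h⟩ := exists_levelGap_eq s (windowSpread τ y k) (gap τ y k t)
  exact h ▸ setGap_gap_nonneg ha hy ht S

theorem windowSpread_le_sub_levelGap (hδ : 0 ≤ δ) (ha : IsUniformlyAdmissible δ a)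
    (hy : IsShiftedTrajectory a y) {k t : ℕ} (ht : k + τ ≤ t) :
    windowSpread τ y t ≤ windowSpread τ y k -
      δ ^ τ * levelGap (2 * n) (windowSpread τ y k) (gap τ y k t) := by
  obtain ⟨S, hS, h⟩ := exists_levelGap_eq (2 * n) (windowSpread τ y k) (gap τ y k t)
  obtain ⟨σ, hσ⟩ := isFullSide_of_mem_levelSets hS
  exact windowSpread_le_of_le_gap hδ ha hy ht (levelGap_nonneg ha hy (by omega) _)
    fun i => h ▸ setGap_le_of_mem (hσ i)

end Stage

/-! ### Existence, superposition and measurability of trajectories -/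

section Existence

variable {n τ : ℕ}

/-- The shifted trajectory with initial data `u 0, …, u τ`. -/
noncomputable def shiftedTrajectory (a : Fin (τ + 1) → ℕ → Matrix (Fin n) (Fin n) ℝ)
    (u : ℕ → Fin n → ℝ) (t : ℕ) (i : Fin n) : ℝ :=
  if _h : t ≤ τ then u t i
  else ∑ l : Fin (τ + 1), ∑ j, a l (t - τ - 1) i j * shiftedTrajectory a u (t - 1 - (l : ℕ)) j
termination_by t
decreasing_by omega

variable {a : Fin (τ + 1) → ℕ → Matrix (Fin n) (Fin n) ℝ} {u : ℕ → Fin n → ℝ}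

theorem shiftedTrajectory_of_le {t : ℕ} (ht : t ≤ τ) (i : Fin n) :
    shiftedTrajectory a u t i = u t i := by
  rw [shiftedTrajectory, dif_pos ht]

theorem isShiftedTrajectory_shiftedTrajectory (a : Fin (τ + 1) → ℕ → Matrix (Fin n) (Fin n) ℝ)
    (u : ℕ → Fin n → ℝ) : IsShiftedTrajectory a (shiftedTrajectory a u) := by
  intro k i
  rw [shiftedTrajectory, dif_neg (by omega)]
  simp only [Nat.add_sub_cancel, show k + τ + 1 - τ - 1 = k by omega]

/-- A trajectory is the superposition of those that start from the unit initial data. -/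
theorem IsShiftedTrajectory.eq_sum {y : ℕ → Fin n → ℝ} (hy : IsShiftedTrajectory a y) (t : ℕ)
    (i : Fin n) : y t i = ∑ b : Fin (τ + 1) × Fin n, y b.1 b.2 *
      shiftedTrajectory a (fun r j => if r = b.1 ∧ j = b.2 then 1 else 0) t i := by
  induction t using Nat.strong_induction_on generalizing i with
  | _ t ih =>
    by_cases ht : t ≤ τ
    · rw [Finset.sum_eq_single ((⟨t, by omega⟩ : Fin (τ + 1)), i)]
      · simp [shiftedTrajectory_of_le ht]
      · rintro ⟨r, j⟩ - hne
        rw [shiftedTrajectory_of_le ht, if_neg, mul_zero]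
        rintro ⟨h1, h2⟩
        exact hne (Prod.ext (Fin.ext h1.symm) h2.symm)
      · simp
    · obtain ⟨q, rfl⟩ : ∃ q, t = q + τ + 1 := ⟨t - τ - 1, by omega⟩
      rw [hy q i]
      simp only [isShiftedTrajectory_shiftedTrajectory a _ q i, Finset.mul_sum]
      symm
      rw [Finset.sum_comm]
      refine Finset.sum_congr rfl fun l _ => ?_
      rw [Finset.sum_comm]
      refine Finset.sum_congr rfl fun j _ => ?_
      rw [ih (q + τ - (l : ℕ)) (by omega) j, Finset.mul_sum]
      exact Finset.sum_congr rfl fun b _ => by ring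

theorem IsTrajectory.isShiftedTrajectory {x : ℤ → Fin n → ℝ} (hx : IsTrajectory a x) :
    IsShiftedTrajectory a fun t => x ((t : ℤ) - τ) := by
  intro k i
  have h1 : ((k + τ + 1 : ℕ) : ℤ) - τ = k + 1 := by push_cast; ring
  simp only [h1, hx k i]
  refine Finset.sum_congr rfl fun l _ => Finset.sum_congr rfl fun j _ => ?_
  have h2 : ((k + τ - (l : ℕ) : ℕ) : ℤ) - τ = (k : ℤ) - ((l : ℕ) : ℤ) := by
    have := l.2
    omega
  rw [h2]

/-- Consensus along the trajectories with unit initial data implies consensus. -/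
theorem reachesConsensus_of_unit
    (h : ∀ b : Fin (τ + 1) × Fin n, ∃ c : ℝ, ∀ i, Tendsto (fun t =>
      shiftedTrajectory a (fun r j => if r = b.1 ∧ j = b.2 then 1 else 0) t i) atTop (𝓝 c)) :
    ReachesConsensus a := by
  intro x hx
  choose c hc using h
  refine ⟨∑ b : Fin (τ + 1) × Fin n, x (((b.1 : ℕ) : ℤ) - τ) b.2 * c b, fun i => ?_⟩
  have h1 : Tendsto (fun t : ℕ => x ((t : ℤ) - τ) i) atTop
      (𝓝 (∑ b : Fin (τ + 1) × Fin n, x (((b.1 : ℕ) : ℤ) - τ) b.2 * c b)) := by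
    simp only [hx.isShiftedTrajectory.eq_sum _ i]
    exact tendsto_finsetSum _ fun b _ => (hc b i).const_mul _
  have h2 := h1.comp (tendsto_add_atTop_nat τ)
  refine h2.congr fun k => ?_
  simp

/-- The state at shifted time `t` only involves weights up to time `t - τ - 1`. Measurability for `ℱ
t` suffices, as a block starting at `t` uses weights from `t + 1` on. -/
theorem measurable_shiftedTrajectory {Ω : Type*} {m0 : MeasurableSpace Ω} {ℱ : Filtration ℕ m0}
    {A : Fin (τ + 1) → ℕ → Ω → Matrix (Fin n) (Fin n) ℝ}
    (hA : ∀ l i j, Adapted ℱ (fun k ω => A l k ω i j)) (u : ℕ → Fin n → ℝ) (t : ℕ) (i : Fin n) :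
    Measurable[ℱ t] fun ω => shiftedTrajectory (fun l k => A l k ω) u t i := by
  induction t using Nat.strong_induction_on generalizing i with
  | _ t ih =>
    by_cases ht : t ≤ τ
    · simp only [shiftedTrajectory_of_le ht]
      exact measurable_const
    · obtain ⟨q, rfl⟩ : ∃ q, t = q + τ + 1 := ⟨t - τ - 1, by omega⟩
      have h : ∀ ω, shiftedTrajectory (fun l k => A l k ω) u (q + τ + 1) i = _ := fun ω =>
        isShiftedTrajectory_shiftedTrajectory (fun l k => A l k ω) u q i
      simp only [h]
      refine Finset.measurable_fun_sum _ fun l _ => Finset.measurable_fun_sum _ fun j _ => ?_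
      exact ((hA l i j q).mono (ℱ.mono (by omega)) le_rfl).mul
        ((ih (q + τ - l) (by omega) j).mono (ℱ.mono (by omega)) le_rfl)

end Existence

/-! ### Conditional growth of the level gap and decay of the expected spread -/

section Probability

variable {Ω : Type*} {m0 : MeasurableSpace Ω} {μ : Measure Ω} {ℱ : Filtration ℕ m0} {n τ : ℕ}
  {δ : ℝ} {h : ℕ} {A : Fin (τ + 1) → ℕ → Ω → Matrix (Fin n) (Fin n) ℝ}
  {y : ℕ → Ω → Fin n → ℝ} {C : ℝ}

theorem matrixCondExp_sum_totalWeight (m i j) :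
    (fun ω => matrixCondExp μ (ℱ m) (fun ω' => ∑ k ∈ Finset.Icc (m + 1) (m + h),
      totalWeight A k ω') ω i j) =
    μ[fun ω => blockWeight (fun l k => A l k ω) m h i j | ℱ m] := by
  ext ω
  simp only [matrixCondExp, Matrix.of_apply, blockWeight, totalWeight, Matrix.sum_apply]

theorem measurable_blockWeight (hA : ∀ l i j, Adapted ℱ (fun k ω => A l k ω i j)) (m : ℕ)
    (i j : Fin n) : Measurable fun ω => blockWeight (fun l k => A l k ω) m h i j :=
  Finset.measurable_fun_sum _ fun q _ => Finset.measurable_fun_sum _ fun l _ =>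
    (hA l i j q).mono (ℱ.le q) le_rfl

variable [IsProbabilityMeasure μ]

theorem integrable_of_nonneg_of_le {f : Ω → ℝ} (hf : Measurable f) (h0 : ∀ᵐ ω ∂μ, 0 ≤ f ω)
    {C : ℝ} (hC : ∀ᵐ ω ∂μ, f ω ≤ C) : Integrable f μ := by
  refine Integrable.of_bound hf.aestronglyMeasurable C ?_
  filter_upwards [h0, hC] with ω h1 h2
  rwa [Real.norm_of_nonneg h1]

variable [NeZero n]

/-- The optimal set and the tree edge are random. The estimate is therefore proved for each fixed
set and edge, and the optimal choice is made pointwise only afterwards; no measurable selection is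
needed. -/
theorem ae_mul_levelGap_le_condExp (hδ : 0 < δ) (hh : 0 < h)
    (hA : ∀ l i j, Adapted ℱ (fun k ω => A l k ω i j))
    (hadm : ∀ᵐ ω ∂μ, IsUniformlyAdmissible δ fun l k => A l k ω)
    (hmeas : ∀ t i, Measurable[ℱ t] fun ω => y t ω i)
    (hy : ∀ᵐ ω ∂μ, IsShiftedTrajectory (fun l k => A l k ω) fun t => y t ω)
    {k : ℕ} (hC : ∀ᵐ ω ∂μ, windowSpread τ (fun t => y t ω) k ≤ C) {t : ℕ} (ht : k + τ ≤ t)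
    (htree : ∀ᵐ ω ∂μ, HasDeltaSpanningTree δ (matrixCondExp μ (ℱ t)
      (fun ω' => ∑ k ∈ Finset.Icc (t + 1) (t + h), totalWeight A k ω') ω)) (s : ℕ) :
    ∀ᵐ ω ∂μ, blockConst δ τ h * δ *
        levelGap s (windowSpread τ (fun t => y t ω) k) (gap τ (fun t => y t ω) k t) ≤
      (μ[fun ω => levelGap (s + 1) (windowSpread τ (fun t => y t ω) k)
        (gap τ (fun t => y t ω) k (t + (τ + h + 1))) | ℱ t]) ω := by
  classical
  set F : Finset (Fin n × Bool) → Ω → ℝ := fun S ω =>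
    setGap (windowSpread τ (fun t => y t ω) k) (gap τ (fun t => y t ω) k t) S with hF
  set Φ : Ω → ℝ := fun ω => levelGap (s + 1) (windowSpread τ (fun t => y t ω) k)
        (gap τ (fun t => y t ω) k (t + (τ + h + 1))) with hΦ
  have hmono : ∀ {r t : ℕ}, r ≤ t → ∀ i, Measurable[ℱ t] fun ω => y r ω i := fun hr i =>
    (hmeas _ i).mono (ℱ.mono hr) le_rfl
  have hm0 : ∀ r i, Measurable fun ω => y r ω i := fun r i => (hmeas r i).mono (ℱ.le r) le_rfl
  have hFm : ∀ S, Measurable[ℱ t] (F S) := fun S =>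
    measurable_setGap (measurable_windowSpread fun r hr i => hmono (by omega) i)
      (fun p => measurable_gap ht (fun r hr i => hmono hr i) p) S
  have hΦm : Measurable Φ := measurable_levelGap (measurable_windowSpread fun r _ i => hm0 r i)
      (fun p => measurable_gap (by omega) (fun r _ i => hm0 r i) p) _
  have hΦi : Integrable Φ μ := by
    refine integrable_of_nonneg_of_le hΦm (C := C) ?_ ?_
    · filter_upwards [hadm, hy] with ω h1 h2
      exact levelGap_nonneg h1 h2 (by omega) _
    · filter_upwards [hadm, hy, hC] with ω h1 h2 h3
      exact (levelGap_le_windowSpread h1 h2 (by omega) _).trans h3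
  have hF0 : ∀ S, ∀ᵐ ω ∂μ, 0 ≤ F S ω := fun S => by
    filter_upwards [hadm, hy] with ω h1 h2
    exact setGap_gap_nonneg h1 h2 (by omega) S
  have hFC : ∀ S, ∀ᵐ ω ∂μ, F S ω ≤ C := fun S => by
    filter_upwards [hadm, hy, hC] with ω h1 h2 h3
    exact (setGap_le (gap_le_windowSpread h1 h2 (by omega)) S).trans h3
  have hFi : ∀ S, Integrable (F S) μ := fun S =>
    integrable_of_nonneg_of_le ((hFm S).mono (ℱ.le t) le_rfl) (hF0 S) (hFC S)
  have hfull : ∀ S, S ∈ levelSets n s → IsFullSide S →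
      ∀ᵐ ω ∂μ, blockConst δ τ h * δ * F S ω ≤ (μ[Φ | ℱ t]) ω := fun S hS hSf => by
    have h1 : (fun ω => blockConst δ τ h * δ * F S ω) ≤ᵐ[μ] Φ := by
      filter_upwards [hadm, hy] with ω h1 h2
      exact (mul_setGap_le_setGap hδ.le h1 h2 ht (blockConst_mul_le hδ.le h1.le_one hh) S).trans
        (setGap_le_levelGap (mem_levelSets_succ_of_isFullSide hS hSf))
    have h2 := condExp_mono (m := ℱ t) ((hFi S).const_mul _) hΦi h1
    have hcF : StronglyMeasurable[ℱ t] fun ω => blockConst δ τ h * δ * F S ω :=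
      (measurable_const.mul (hFm S)).stronglyMeasurable
    rwa [condExp_of_stronglyMeasurable (ℱ.le t) hcF ((hFi S).const_mul _)] at h2
  have hgrow : ∀ S i j σ, S ∈ levelSets n s → ¬ IsFullSide S → (j, σ) ∈ S → (i, σ) ∉ S →
      ∀ᵐ ω ∂μ, blockConst δ τ h * F S ω *
        (μ[fun ω => blockWeight (fun l k => A l k ω) t h i j | ℱ t]) ω ≤ (μ[Φ | ℱ t]) ω := by
    intro S i j σ hS hSf hj hi
    set W : Ω → ℝ := fun ω => blockWeight (fun l k => A l k ω) t h i j with hW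
    have hWi : Integrable W μ := by
      refine integrable_of_nonneg_of_le (measurable_blockWeight hA t i j) (C := h) ?_ ?_
      · filter_upwards [hadm] with ω h1 using blockWeight_nonneg h1 t h i j
      · filter_upwards [hadm] with ω h1 using blockWeight_le h1 t h i j
    have hcF : StronglyMeasurable[ℱ t] fun ω => blockConst δ τ h * F S ω :=
      (measurable_const.mul (hFm S)).stronglyMeasurable
    have hcb : ∀ᵐ ω ∂μ, ‖blockConst δ τ h * F S ω‖ ≤ blockConst δ τ h * C := by
      filter_upwards [hF0 S, hFC S] with ω h1 h2
      have hc := (blockConst_pos (τ := τ) hδ hh).le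
      rw [Real.norm_of_nonneg (mul_nonneg hc h1)]
      exact mul_le_mul_of_nonneg_left h2 hc
    have hint : Integrable ((fun ω => blockConst δ τ h * F S ω) * W) μ :=
      hWi.bdd_mul (hcF.mono (ℱ.le t)).aestronglyMeasurable hcb
    have h1 : (fun ω => blockConst δ τ h * F S ω) * W ≤ᵐ[μ] Φ := by
      filter_upwards [hadm, hy] with ω h1 h2
      have h3 := (mul_setGap_le_setGap_insert hδ.le h1 h2 ht hh (i := i) hj).trans
        (setGap_le_levelGap (insert_mem_levelSets hS hSf hi))
      simp only [Pi.mul_apply]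
      linarith
    have h2 := condExp_mono (m := ℱ t) hint hΦi h1
    -- The set gap at time `t` is known at time `t`, so it comes out of the conditional expectation
    -- and only the edge weight is averaged.
    have h3 := condExp_stronglyMeasurable_mul_of_bound (ℱ.le t) hcF hWi _ hcb
    filter_upwards [h2, h3] with ω h4 h5
    rw [h5] at h4
    exact h4
  -- There are finitely many sets and edges, so one null set serves for all of them.
  have hfull' : ∀ᵐ ω ∂μ, ∀ S, S ∈ levelSets n s → IsFullSide S →
      blockConst δ τ h * δ * F S ω ≤ (μ[Φ | ℱ t]) ω := by
    simpa only [ae_all_iff, eventually_imp_distrib_left] using hfull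
  have hgrow' : ∀ᵐ ω ∂μ, ∀ S i j σ, S ∈ levelSets n s → ¬ IsFullSide S → (j, σ) ∈ S →
      (i, σ) ∉ S → blockConst δ τ h * F S ω *
        (μ[fun ω => blockWeight (fun l k => A l k ω) t h i j | ℱ t]) ω ≤ (μ[Φ | ℱ t]) ω := by
    simpa only [ae_all_iff, eventually_imp_distrib_left] using hgrow
  have hF0' : ∀ᵐ ω ∂μ, ∀ S, 0 ≤ F S ω := ae_all_iff.2 hF0
  filter_upwards [hfull', hgrow', hF0', htree] with ω h1 h2 h3 h4
  obtain ⟨S, hS, hSeq⟩ := exists_levelGap_eq s (windowSpread τ (fun t => y t ω) k)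
    (gap τ (fun t => y t ω) k t)
  rw [hSeq]
  by_cases hSf : IsFullSide S
  · exact h1 S hS hSf
  obtain ⟨i, j, σ, hj, hi, hij⟩ := h4.exists_edge hS.1 hSf
  have h5 := congrFun (matrixCondExp_sum_totalWeight (μ := μ) (ℱ := ℱ) (A := A) (h := h) t i j) ω
  rw [h5] at hij
  refine le_trans ?_ (h2 S i j σ hS hSf hj hi)
  have h6 := mul_le_mul_of_nonneg_left hij
    (mul_nonneg (blockConst_pos (τ := τ) hδ hh).le (h3 S))
  calc _ = blockConst δ τ h * F S ω * δ := by simp only [hF]; ring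
    _ ≤ _ := h6

theorem integrable_windowSpread
    (hadm : ∀ᵐ ω ∂μ, IsUniformlyAdmissible δ fun l k => A l k ω)
    (hmeas : ∀ t i, Measurable[ℱ t] fun ω => y t ω i)
    (hy : ∀ᵐ ω ∂μ, IsShiftedTrajectory (fun l k => A l k ω) fun t => y t ω)
    (hC : ∀ᵐ ω ∂μ, windowSpread τ (fun t => y t ω) 0 ≤ C) (k : ℕ) :
    Integrable (fun ω => windowSpread τ (fun t => y t ω) k) μ := by
  refine integrable_of_nonneg_of_le (measurable_windowSpread fun r _ i =>
    (hmeas r i).mono (ℱ.le r) le_rfl) (ae_of_all _ fun ω => windowSpread_nonneg _ _) (C := C) ?_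
  filter_upwards [hadm, hy, hC] with ω h1 h2 h3
  exact (antitone_windowSpread h1 h2 (Nat.zero_le k)).trans h3

theorem integrable_levelGap
    (hadm : ∀ᵐ ω ∂μ, IsUniformlyAdmissible δ fun l k => A l k ω)
    (hmeas : ∀ t i, Measurable[ℱ t] fun ω => y t ω i)
    (hy : ∀ᵐ ω ∂μ, IsShiftedTrajectory (fun l k => A l k ω) fun t => y t ω)
    {k : ℕ} (hC : ∀ᵐ ω ∂μ, windowSpread τ (fun t => y t ω) k ≤ C) {t : ℕ} (ht : k + τ ≤ t)
    (s : ℕ) :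
    Integrable (fun ω => levelGap s (windowSpread τ (fun t => y t ω) k)
      (gap τ (fun t => y t ω) k t)) μ := by
  have hm0 : ∀ r i, Measurable fun ω => y r ω i := fun r i => (hmeas r i).mono (ℱ.le r) le_rfl
  refine integrable_of_nonneg_of_le (measurable_levelGap
    (measurable_windowSpread fun r _ i => hm0 r i)
    (fun p => measurable_gap ht (fun r _ i => hm0 r i) p) _) (C := C) ?_ ?_
  · filter_upwards [hadm, hy] with ω h1 h2
    exact levelGap_nonneg h1 h2 (by omega) _
  · filter_upwards [hadm, hy, hC] with ω h1 h2 h3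
    exact (levelGap_le_windowSpread h1 h2 (by omega) _).trans h3

/-- The contraction constant of `2 n` blocks. -/
noncomputable def cycleConst (δ : ℝ) (n τ h : ℕ) : ℝ :=
  δ ^ τ * ((blockConst δ τ h * δ) ^ (2 * n) * (1 / 2))

theorem integral_windowSpread_le (hδ : 0 < δ) (hh : 0 < h)
    (hA : ∀ l i j, Adapted ℱ (fun k ω => A l k ω i j))
    (hadm : ∀ᵐ ω ∂μ, IsUniformlyAdmissible δ fun l k => A l k ω)
    (hmeas : ∀ t i, Measurable[ℱ t] fun ω => y t ω i)
    (hy : ∀ᵐ ω ∂μ, IsShiftedTrajectory (fun l k => A l k ω) fun t => y t ω)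
    (hC : ∀ᵐ ω ∂μ, windowSpread τ (fun t => y t ω) 0 ≤ C)
    (htree : ∀ m, ∀ᵐ ω ∂μ, HasDeltaSpanningTree δ (matrixCondExp μ (ℱ m)
      (fun ω' => ∑ k ∈ Finset.Icc (m + 1) (m + h), totalWeight A k ω') ω)) (k : ℕ) :
    ∫ ω, windowSpread τ (fun t => y t ω) (k + (τ + 2 * n * (τ + h + 1))) ∂μ ≤
      (1 - cycleConst δ n τ h) * ∫ ω, windowSpread τ (fun t => y t ω) k ∂μ := by
  have hCk : ∀ᵐ ω ∂μ, windowSpread τ (fun t => y t ω) k ≤ C := by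
    filter_upwards [hadm, hy, hC] with ω h1 h2 h3
    exact (antitone_windowSpread h1 h2 (Nat.zero_le k)).trans h3
  have hVi := integrable_windowSpread hadm hmeas hy hC
  have hΦi : ∀ {t : ℕ}, k + τ ≤ t → ∀ s, Integrable (fun ω =>
      levelGap s (windowSpread τ (fun t => y t ω) k) (gap τ (fun t => y t ω) k t)) μ :=
    fun ht s => integrable_levelGap hadm hmeas hy hCk ht s
  have hc : 0 ≤ blockConst δ τ h * δ := mul_nonneg (blockConst_pos hδ hh).le hδ.le
  -- The chain starts at `k + τ`, the first time from which the persistence bounds apply and at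
  -- which the window is already known. The reference extremes stay those of the window at `k`
  -- throughout.
  have hstage : ∀ s, (blockConst δ τ h * δ) ^ s *
      ((1 / 2) * ∫ ω, windowSpread τ (fun t => y t ω) k ∂μ) ≤
      ∫ ω, levelGap s (windowSpread τ (fun t => y t ω) k)
        (gap τ (fun t => y t ω) k (k + τ + s * (τ + h + 1))) ∂μ := by
    intro s
    induction s with
    | zero =>
      rw [pow_zero, one_mul, ← integral_const_mul]
      refine integral_mono_ae ((hVi k).const_mul _) (hΦi (by omega) 0) (ae_of_all _ fun ω => ?_)
      have := half_le_levelGap_zero (windowSpread_nonneg (τ := τ) (fun t => y t ω) k)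
        (gap_true_add_gap_false (τ := τ) (fun t => y t ω) k (k + τ + 0 * (τ + h + 1)))
      simp only
      linarith
    | succ s ih =>
      set t := k + τ + s * (τ + h + 1) with ht
      have ht' : k + τ + (s + 1) * (τ + h + 1) = t + (τ + h + 1) := by rw [ht]; ring
      rw [ht']
      have h1 := ae_mul_levelGap_le_condExp hδ hh hA hadm hmeas hy hCk
        (show k + τ ≤ t by omega) (htree t) s
      have h2 := integral_mono_ae ((hΦi (show k + τ ≤ t by omega) s).const_mul _)
        integrable_condExp h1
      rw [integral_const_mul, integral_condExp (ℱ.le t)] at h2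
      refine le_trans ?_ h2
      rw [pow_succ', mul_assoc]
      exact mul_le_mul_of_nonneg_left ih hc
  have hend := hstage (2 * n)
  have hlast := integral_mono_ae (hVi (k + τ + 2 * n * (τ + h + 1)))
    ((hVi k).sub ((hΦi (show k + τ ≤ k + τ + 2 * n * (τ + h + 1) by omega) (2 * n)).const_mul
      (δ ^ τ))) (by
      filter_upwards [hadm, hy] with ω h1 h2
      exact windowSpread_le_sub_levelGap hδ.le h1 h2 (by omega))
  simp only [Pi.sub_apply] at hlast
  rw [integral_sub (hVi k) ((hΦi (by omega) _).const_mul _), integral_const_mul] at hlast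
  rw [← add_assoc]
  have h3 := mul_le_mul_of_nonneg_left hend (pow_nonneg hδ.le τ)
  unfold cycleConst
  linarith

theorem ae_tendsto_windowSpread (hδ : 0 < δ) (hh : 0 < h)
    (hA : ∀ l i j, Adapted ℱ (fun k ω => A l k ω i j))
    (hadm : ∀ᵐ ω ∂μ, IsUniformlyAdmissible δ fun l k => A l k ω)
    (hmeas : ∀ t i, Measurable[ℱ t] fun ω => y t ω i)
    (hy : ∀ᵐ ω ∂μ, IsShiftedTrajectory (fun l k => A l k ω) fun t => y t ω)
    (hC : ∀ᵐ ω ∂μ, windowSpread τ (fun t => y t ω) 0 ≤ C)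
    (htree : ∀ m, ∀ᵐ ω ∂μ, HasDeltaSpanningTree δ (matrixCondExp μ (ℱ m)
      (fun ω' => ∑ k ∈ Finset.Icc (m + 1) (m + h), totalWeight A k ω') ω)) :
    ∀ᵐ ω ∂μ, Tendsto (windowSpread τ fun t => y t ω) atTop (𝓝 0) := by
  have hVi := integrable_windowSpread hadm hmeas hy hC
  have hV0 : ∀ k, 0 ≤ ∫ ω, windowSpread τ (fun t => y t ω) k ∂μ := fun k =>
    integral_nonneg fun ω => windowSpread_nonneg _ _
  set N := τ + 2 * n * (τ + h + 1) with hN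
  have hN0 : 0 < N := by
    have := NeZero.pos n
    positivity
  -- Truncation at `0` makes the ratio nonnegative without an upper bound on `cycleConst`.
  set θ : ℝ := max 0 (1 - cycleConst δ n τ h) with hθ
  have hθ0 : 0 ≤ θ := le_max_left _ _
  have hθ1 : θ < 1 := by
    have : 0 < cycleConst δ n τ h := by
      have := blockConst_pos (τ := τ) hδ hh
      unfold cycleConst
      positivity
    exact max_lt one_pos (by linarith)
  have hgeom : ∀ r : ℕ, ∫ ω, windowSpread τ (fun t => y t ω) (r * N) ∂μ ≤
      θ ^ r * ∫ ω, windowSpread τ (fun t => y t ω) 0 ∂μ := by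
    intro r
    induction r with
    | zero => simp
    | succ r ih =>
      rw [add_one_mul]
      calc _ ≤ (1 - cycleConst δ n τ h) * ∫ ω, windowSpread τ (fun t => y t ω) (r * N) ∂μ :=
            integral_windowSpread_le hδ hh hA hadm hmeas hy hC htree (r * N)
        _ ≤ θ * ∫ ω, windowSpread τ (fun t => y t ω) (r * N) ∂μ :=
            mul_le_mul_of_nonneg_right (le_max_right _ _) (hV0 _)
        _ ≤ θ * (θ ^ r * ∫ ω, windowSpread τ (fun t => y t ω) 0 ∂μ) :=
            mul_le_mul_of_nonneg_left ih hθ0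
        _ = _ := by ring
  have hlim : Tendsto (fun r : ℕ => ∫ ω, windowSpread τ (fun t => y t ω) (r * N) ∂μ) atTop
      (𝓝 (∫ _ω, (0 : ℝ) ∂μ)) := by
    rw [integral_zero]
    refine squeeze_zero (fun r => hV0 _) hgeom ?_
    simpa using (tendsto_pow_atTop_nhds_zero_of_lt_one hθ0 hθ1).mul_const _
  -- A nonincreasing sequence of nonnegative functions whose integrals tend to `0` tends to `0`
  -- almost everywhere; monotonicity in `k` then fills in the times between multiples of `N`.
  have hsub := tendsto_of_integral_tendsto_of_antitone (μ := μ)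
    (f := fun r ω => windowSpread τ (fun t => y t ω) (r * N)) (F := fun _ => 0)
    (fun r => hVi _) (integrable_zero _ _ _) hlim (by
      filter_upwards [hadm, hy] with ω h1 h2
      exact fun r r' hr => antitone_windowSpread h1 h2 (Nat.mul_le_mul_right N hr))
    (ae_of_all _ fun ω r => windowSpread_nonneg _ _)
  filter_upwards [hsub, hadm, hy] with ω h1 h2 h3
  refine squeeze_zero (fun k => windowSpread_nonneg _ _)
    (fun k => antitone_windowSpread h2 h3 (Nat.div_mul_le_self k N)) ?_
  exact h1.comp (Nat.tendsto_div_const_atTop hN0.ne')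

end Probability

end DelayedConsensus

theorem mainTheorem6 {Ω : Type*} {m0 : MeasurableSpace Ω} (μ : Measure Ω)
    [IsProbabilityMeasure μ] (ℱ : Filtration ℕ m0) (n τ : ℕ)
    (A : Fin (τ + 1) → ℕ → Ω → Matrix (Fin n) (Fin n) ℝ)
    (hadapted : ∀ l i j, Adapted ℱ (fun k ω => A l k ω i j))
    (hadm : ∀ᵐ ω ∂μ, ∀ k, DelayedConsensus.IsAdmissible (fun l => A l k ω))
    (hyp : ∃ δ : ℝ, 0 < δ ∧ ∃ h : ℕ, 0 < h ∧
      (∀ᵐ ω ∂μ, ∀ k i j,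
        (δ • (1 : Matrix (Fin n) (Fin n) ℝ)) i j ≤ DelayedConsensus.totalWeight A k ω i j) ∧
      ∀ m : ℕ, ∀ᵐ ω ∂μ, DelayedConsensus.HasDeltaSpanningTree δ
        (DelayedConsensus.matrixCondExp μ (ℱ m)
          (fun ω' => ∑ k ∈ Finset.Icc (m + 1) (m + h),
            DelayedConsensus.totalWeight A k ω') ω)) :
    ∀ᵐ ω ∂μ, DelayedConsensus.ReachesConsensus (fun l k => A l k ω) := by
  open DelayedConsensus in
  obtain ⟨δ, hδ, h, hh, hB, htree⟩ := hyp
  rcases Nat.eq_zero_or_pos n with rfl | hn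
  · exact ae_of_all _ fun ω x _ => ⟨0, fun i => i.elim0⟩
  have : NeZero n := ⟨hn.ne'⟩
  have hadm' : ∀ᵐ ω ∂μ, IsUniformlyAdmissible δ fun l k => A l k ω := by
    filter_upwards [hadm, hB] with ω h1 h2
    refine ⟨h1, fun k i => ?_⟩
    have h3 := h2 k i i
    -- Delayed self-weights vanish, so the diagonal of `B(k)` is the undelayed self-weight, which is
    -- thus at least `δ`.
    rw [totalWeight, Matrix.sum_apply, Finset.sum_eq_single 0
      (fun l _ hl => (h1 k).no_self_delay l hl i) (by simp)] at h3
    simpa using h3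
  have hunit : ∀ b : Fin (τ + 1) × Fin n, ∀ᵐ ω ∂μ, ∃ c : ℝ, ∀ i, Tendsto (fun t =>
      shiftedTrajectory (fun l k => A l k ω)
        (fun r j => if r = b.1 ∧ j = b.2 then 1 else 0) t i) atTop (𝓝 c) := by
    intro b
    have hy : ∀ ω, IsShiftedTrajectory (fun l k => A l k ω) fun t =>
        shiftedTrajectory (fun l k => A l k ω)
          (fun r j => if r = b.1 ∧ j = b.2 then 1 else 0) t := fun ω =>
      isShiftedTrajectory_shiftedTrajectory _ _
    have hlim := ae_tendsto_windowSpread (C := 1) hδ hh hadapted hadm'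
      (fun t i => measurable_shiftedTrajectory hadapted
        (fun r j => if r = b.1 ∧ j = b.2 then 1 else 0) t i)
      (ae_of_all μ hy) (ae_of_all _ fun ω => ?_) htree
    · filter_upwards [hlim, hadm'] with ω h1 h2
      exact exists_tendsto_of_windowSpread h2 (hy ω) h1
    · have h1 : windowMax τ (fun t => shiftedTrajectory (fun l k => A l k ω)
          (fun r j => if r = b.1 ∧ j = b.2 then 1 else 0) t) 0 ≤ 1 :=
        windowMax_le fun r hr i => by
          simp only [zero_add, shiftedTrajectory_of_le hr]
          split_ifs <;> norm_num
      have h2 : 0 ≤ windowMin τ (fun t => shiftedTrajectory (fun l k => A l k ω)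
          (fun r j => if r = b.1 ∧ j = b.2 then 1 else 0) t) 0 :=
        le_windowMin fun r hr i => by
          simp only [zero_add, shiftedTrajectory_of_le hr]
          split_ifs <;> norm_num
      unfold windowSpread
      linarith
  filter_upwards [ae_all_iff.2 hunit] with ω hω
  exact reachesConsensus_of_unit hω
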